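/- Let $n$ be a non-negative integer. For a permutation $\sigma\in S_n$ with one-line notation $[\sigma_1,\dots,\sigma_n]$, the Robinson–Schensted (RS) shape $\operatorname{sh}(\sigma)$ is the partition of $n$ whose parts are the row lengths of the tableau obtained from the empty tableau by inserting $\sigma_1,\dots,\sigma_n$ successively by row insertion. (To insert $a$ into a row: if $a$ is greater than every entry of the row, add $a$ at its end and stop; otherwise let $a$ replace the leftmost entry of the row that is greater than $a$, and insert the replaced entry into the next row in the same way. An insertion starts in the first row, and a row below the last one counts as an empty row.) For a partition $\alpha$ of $n$, let $$\mathcal S_\alpha=\{\operatorname{sh}(\sigma) : \sigma\in S_n \text{ has cycle type } \alpha\},$$ where the cycle type of $\sigma$ is the partition of $n$ formed by the lengths of its cycles, fixed points included. **Proposition.** Let $0\le k\le r$ be integers with $2(r-k)+k=n$, and let $\alpha=(2^{r-k},1^k)$, the partition of $n$ with $r-k$ parts equal to $2$ and $k$ parts equal to $1$. Then $$\mathcal S_\alpha=\{\lambda\vdash n : \text{the Young diagram of } \lambda \text{ has exactly } k \text{ columns of odd length}\}.$$ -/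

import Mathlib

namespace RobinsonSchensted

section Insertion

variable {A : Type*} [LinearOrder A]

/-- Row insertion of `a` into one row. If no entry of the row is greater than `a`, then `a` is
added at the end and nothing is bumped; otherwise `a` replaces the leftmost entry greater than `a`.
The result is the new row, together with the bumped entry, if there is one. -/
def insertRow (a : A) : List A → List A × Option A
  | [] => ([a], none)
  | b :: bs =>
      if a < b then (a :: bs, some b)
      else (b :: (insertRow a bs).1, (insertRow a bs).2)

/-- Row insertion of `a` into a tableau, given as the list of its rows from top to bottom: `a` is
inserted into the first row, the entry bumped from it (if there is one) into the second row, and so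
on, until an entry is added at the end of a (possibly new) row. -/
def insertTableau (a : A) : List (List A) → List (List A)
  | [] => [[a]]
  | R :: T =>
      match (insertRow a R).2 with
      | none => (insertRow a R).1 :: T
      | some b => (insertRow a R).1 :: insertTableau b T

/-- The insertion tableau of a word: its letters are row-inserted one after another, from left to
right, starting from the empty tableau. -/
def insertionTableau (w : List A) : List (List A) :=
  w.foldl (fun T a => insertTableau a T) []

theorem insertRow_none {a : A} {R : List A} (h : (insertRow a R).2 = none) :
    (insertRow a R).1.length = R.length + 1 := by
  induction R with
  | nil => rfl
  | cons b bs ih =>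
    unfold insertRow at h ⊢
    split_ifs at h ⊢
    simpa using ih h

theorem insertRow_some {a b : A} {R : List A} (h : (insertRow a R).2 = some b) :
    (insertRow a R).1.length = R.length := by
  induction R with
  | nil => simp [insertRow] at h
  | cons c cs ih =>
    unfold insertRow at h ⊢
    split_ifs at h ⊢
    · rfl
    · simpa using ih h

theorem insertTableau_sum (a : A) (T : List (List A)) :
    ((insertTableau a T).map List.length).sum = (T.map List.length).sum + 1 := by
  induction T generalizing a with
  | nil => rfl
  | cons R T ih =>
    unfold insertTableau
    split
    · rename_i h
      simp only [List.map_cons, List.sum_cons, insertRow_none h]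
      omega
    · rename_i b h
      simp only [List.map_cons, List.sum_cons, insertRow_some h, ih]
      omega

theorem insertTableau_pos (a : A) (T : List (List A)) (hT : ∀ R ∈ T, 0 < R.length) :
    ∀ R ∈ insertTableau a T, 0 < R.length := by
  induction T generalizing a with
  | nil => simp [insertTableau]
  | cons R T ih =>
    have hR : 0 < R.length := hT R (by simp)
    have hT' : ∀ S ∈ T, 0 < S.length := fun S hS => hT S (by simp [hS])
    unfold insertTableau
    split
    · rename_i h
      intro S hS
      rcases List.mem_cons.1 hS with rfl | hS
      · rw [insertRow_none h]; omega
      · exact hT' S hS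
    · rename_i b h
      intro S hS
      rcases List.mem_cons.1 hS with rfl | hS
      · rw [insertRow_some h]; exact hR
      · exact ih b hT' S hS

theorem insertionTableau_sum (w : List A) :
    ((insertionTableau w).map List.length).sum = w.length := by
  induction w using List.reverseRecOn with
  | nil => rfl
  | append_singleton w a ih =>
    simp only [insertionTableau, List.foldl_append, List.foldl_cons, List.foldl_nil,
      insertTableau_sum, List.length_append, List.length_singleton] at ih ⊢
    omega

theorem insertionTableau_pos (w : List A) : ∀ R ∈ insertionTableau w, 0 < R.length := by
  induction w using List.reverseRecOn with
  | nil => simp [insertionTableau]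
  | append_singleton w a ih =>
    simp only [insertionTableau, List.foldl_append, List.foldl_cons, List.foldl_nil] at ih ⊢
    exact insertTableau_pos a _ ih

end Insertion

/-- The one-line notation `[σ 0, …, σ (n - 1)]` of a permutation of the `n` letters
`0 < 1 < ⋯ < n - 1`. -/
def oneLine {n : ℕ} (σ : Equiv.Perm (Fin n)) : List (Fin n) :=
  List.ofFn σ

/-- The tableau `P` of the pair `RS(σ) = (P, Q)`. -/
def tableauP {n : ℕ} (σ : Equiv.Perm (Fin n)) : List (List (Fin n)) :=
  insertionTableau (oneLine σ)

/-- The RS shape of `σ`: the partition of `n` whose parts are the row lengths of `P` (equivalently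
of `Q`, which by construction has the same shape as `P`). -/
def sh {n : ℕ} (σ : Equiv.Perm (Fin n)) : n.Partition where
  parts := ((tableauP σ).map List.length : List ℕ)
  parts_pos := by
    intro i hi
    simp only [Multiset.mem_coe, List.mem_map] at hi
    obtain ⟨R, hR, rfl⟩ := hi
    exact insertionTableau_pos _ R hR
  parts_sum := by
    rw [Multiset.sum_coe, tableauP, insertionTableau_sum, oneLine, List.length_ofFn]

/-- The conjugacy class of the permutations of cycle type `α` (fixed points count as parts `1`). -/
def conjClass {n : ℕ} (α : n.Partition) : Set (Equiv.Perm (Fin n)) :=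
  {σ | σ.partition.parts = α.parts}

/-- The set of the RS shapes of the permutations of cycle type `α`. -/
def shapes {n : ℕ} (α : n.Partition) : Set n.Partition :=
  {μ | ∃ σ ∈ conjClass α, sh σ = μ}

/-- The length of the `j`-th column (`j ≥ 1`) of the Young diagram of a partition, that is, the
number of the parts that are at least `j`. -/
def colLength {n : ℕ} (μ : n.Partition) (j : ℕ) : ℕ :=
  μ.parts.countP (j ≤ ·)

/-- The number of columns of odd length; the columns are numbered from `1` to the largest part. -/
def numOddColumns {n : ℕ} (μ : n.Partition) : ℕ :=
  ((Finset.Icc 1 μ.parts.sup).filter fun j => Odd (colLength μ j)).card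

end RobinsonSchensted

/-! A permutation has cycle type (2^l, 1^k) exactly when it is an involution with k fixed points.
The proposition therefore follows from two facts: the fixed points of an involution are as many as
the odd columns of its shape (Schützenberger, `numOddColumns_sh`), and every partition is the shape
of an involution (`exists_involution_sh_eq`).

For the first, let `growth g i j` be the shape of the word formed by the values below j at the
positions below i. Fomin's local rule (`growth_local`) determines these shapes cell by cell. The
rule is symmetric, so for an involution `growth g i j = growth g j i`. A diagonal step then adds one
cell to the first row (at a fixed point), adds nothing, or adds one cell to each of two consecutive
rows. Hence the alternating sum of the row lengths counts fixed points (`altSum_growth`); column by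
column, it also counts odd columns (`card_odd_columns`).

For the second, reverse consecutive blocks whose lengths are the column lengths of μ. Each block is
a decreasing run above all earlier values, so its insertion appends one column to the tableau
(`rows_append_decreasing`). -/

namespace RobinsonSchensted

/-! ### Row insertion on infinite sequences of rows -/

section Rows

variable {A : Type*} [LinearOrder A]

/-- Row insertion of an optional letter. -/
def insertRowOpt : Option A → List A → List A × Option A
  | none, R => (R, none)
  | some a, R => insertRow a R

/-- The letter, if any, that is inserted into row `m` when `c` is inserted into the rows `T`. -/
def bumped (c : Option A) (T : ℕ → List A) : ℕ → Option A
  | 0 => c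
  | m + 1 => (insertRowOpt (bumped c T m) (T m)).2

/-- Insertion of an optional letter into an infinite sequence of rows. -/
def insertRows (c : Option A) (T : ℕ → List A) (m : ℕ) : List A :=
  (insertRowOpt (bumped c T m) (T m)).1

theorem bumped_succ' (c : Option A) (T : ℕ → List A) (m : ℕ) :
    bumped c T (m + 1) = bumped (insertRowOpt c (T 0)).2 (fun i => T (i + 1)) m := by
  induction m with
  | zero => rfl
  | succ m ih => rw [bumped, ih, bumped]

theorem bumped_none (T : ℕ → List A) (m : ℕ) : bumped none T m = none := by
  induction m with
  | zero => rfl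
  | succ m ih => rw [bumped, ih, insertRowOpt]

theorem insertRows_none (T : ℕ → List A) : insertRows none T = T := by
  funext m
  rw [insertRows, bumped_none, insertRowOpt]

theorem insertRows_succ (c : Option A) (T : ℕ → List A) (m : ℕ) :
    insertRows c T (m + 1) = insertRows (insertRowOpt c (T 0)).2 (fun i => T (i + 1)) m := by
  rw [insertRows, insertRows, bumped_succ']

theorem getD_insertTableau (a : A) (T : List (List A)) (m : ℕ) :
    (insertTableau a T).getD m [] = insertRows (some a) (fun i => T.getD i []) m := by
  induction T generalizing a m with
  | nil =>
    cases m with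
    | zero => rfl
    | succ m =>
      rw [insertRows_succ]
      simp [insertTableau, insertRowOpt, insertRow, insertRows_none]
  | cons R T ih =>
    unfold insertTableau
    cases m with
    | zero => split <;> rfl
    | succ m =>
      rw [insertRows_succ]
      split
      · rename_i h
        simp [insertRowOpt, h, insertRows_none]
      · rename_i b h
        simpa [insertRowOpt, h] using ih b m

/-- Row `m` of the insertion tableau of a word. -/
def rows (w : List A) (m : ℕ) : List A := (insertionTableau w).getD m []

theorem rows_nil : rows ([] : List A) = fun _ => [] := by
  funext m; simp [rows, insertionTableau]

theorem rows_append_singleton (w : List A) (a : A) :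
    rows (w ++ [a]) = insertRows (some a) (rows w) := by
  funext m
  refine Eq.trans ?_ (getD_insertTableau a (insertionTableau w) m)
  simp [rows, insertionTableau]

theorem insertRow_of_forall_le {a : A} {R : List A} (h : ∀ x ∈ R, x ≤ a) :
    insertRow a R = (R ++ [a], none) := by
  induction R with
  | nil => rfl
  | cons b R ih =>
    rw [insertRow, if_neg (not_lt.2 (h b (by simp))), ih fun x hx => h x (by simp [hx])]
    rfl

/-- The final M is displaced only when no entry before it exceeds a; otherwise the insertion never
reaches it. -/
theorem insertRow_append_of_lt {a M : A} {R : List A} (ha : a < M) :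
    insertRow a (R ++ [M]) =
      if (insertRow a R).2 = none then ((insertRow a R).1, some M)
      else ((insertRow a R).1 ++ [M], (insertRow a R).2) := by
  induction R with
  | nil => simp [insertRow, ha]
  | cons b R ih =>
    simp only [List.cons_append, insertRow]
    split_ifs with h1 h2 h2 <;> simp_all

theorem insertRow_forall {P : A → Prop} {a : A} {R : List A} (ha : P a) (hR : ∀ x ∈ R, P x) :
    (∀ x ∈ (insertRow a R).1, P x) ∧ ∀ x ∈ (insertRow a R).2, P x := by
  induction R with
  | nil => simpa [insertRow] using ha
  | cons b R ih =>
    have := ih fun x hx => hR x (by simp [hx])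
    simp only [List.mem_cons, forall_eq_or_imp] at hR
    rw [insertRow]
    split_ifs
    · simpa [ha, hR.1] using hR.2
    · simpa [hR.1] using this

theorem insertRowOpt_forall {P : A → Prop} {c : Option A} {R : List A} (hc : ∀ x ∈ c, P x)
    (hR : ∀ x ∈ R, P x) :
    (∀ x ∈ (insertRowOpt c R).1, P x) ∧ ∀ x ∈ (insertRowOpt c R).2, P x := by
  cases c with
  | none => simpa [insertRowOpt] using hR
  | some a => exact insertRow_forall (by simpa using hc) hR

theorem bumped_forall {P : A → Prop} {c : Option A} {T : ℕ → List A} (hc : ∀ x ∈ c, P x)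
    (hT : ∀ m, ∀ x ∈ T m, P x) (m : ℕ) : ∀ x ∈ bumped c T m, P x := by
  induction m with
  | zero => exact hc
  | succ m ih => exact (insertRowOpt_forall ih (hT m)).2

theorem insertRows_forall {P : A → Prop} {c : Option A} {T : ℕ → List A} (hc : ∀ x ∈ c, P x)
    (hT : ∀ m, ∀ x ∈ T m, P x) (m : ℕ) : ∀ x ∈ insertRows c T m, P x :=
  (insertRowOpt_forall (bumped_forall hc hT m) (hT m)).1

theorem rows_forall {P : A → Prop} {w : List A} (hw : ∀ x ∈ w, P x) (m : ℕ) :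
    ∀ x ∈ rows w m, P x := by
  induction w using List.reverseRecOn generalizing m with
  | nil => simp [rows_nil]
  | append_singleton w a ih =>
    rw [rows_append_singleton]
    refine insertRows_forall (by simpa using hw a (by simp)) (ih fun x hx => hw x (by simp [hx])) m

theorem length_insertRowOpt (c : Option A) (R : List A) :
    (insertRowOpt c R).1.length =
      R.length + if c ≠ none ∧ (insertRowOpt c R).2 = none then 1 else 0 := by
  cases c with
  | none => simp [insertRowOpt]
  | some a =>
    cases h : (insertRow a R).2 with
    | none => simp [insertRowOpt, h, insertRow_none h]
    | some b => simp [insertRowOpt, h, insertRow_some h]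

/-- Row insertion adds exactly one cell, in the row in which the bumping ends. -/
theorem exists_insertRows_last (a : A) (T : List (List A)) :
    ∃ s, ∀ m, (bumped (some a) (fun i => T.getD i []) m ≠ none ∧
      bumped (some a) (fun i => T.getD i []) (m + 1) = none) ↔ m = s := by
  induction T generalizing a with
  | nil =>
    refine ⟨0, fun m => ?_⟩
    cases m with
    | zero => simp [bumped, insertRowOpt, insertRow]
    | succ m => simp [bumped_succ', insertRowOpt, insertRow, bumped_none]
  | cons R T ih =>
    cases h : (insertRow a R).2 with
    | none =>
      refine ⟨0, fun m => ?_⟩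
      cases m with
      | zero => simp [bumped, insertRowOpt, h]
      | succ m => simp [bumped_succ', insertRowOpt, h, bumped_none]
    | some b =>
      obtain ⟨s, hs⟩ := ih b
      refine ⟨s + 1, fun m => ?_⟩
      cases m with
      | zero => simp [bumped, insertRowOpt, h]
      | succ m =>
        rw [bumped_succ', bumped_succ' _ _ (m + 1)]
        simpa [insertRowOpt, h] using hs m

/-! ### Insertion in the presence of a largest letter -/

/-- The rows `T` with the letter `M` added at the end of row `r`. -/
def addLetter (T : ℕ → List A) (M : A) (r m : ℕ) : List A :=
  T m ++ if m = r then [M] else []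

theorem insertRows_addLetter_zero {T : ℕ → List A} {M : A} (hT : ∀ m, ∀ x ∈ T m, x < M) :
    insertRows (some M) T = addLetter T M 0 := by
  have h : insertRow M (T 0) = (T 0 ++ [M], none) :=
    insertRow_of_forall_le fun x hx => (hT 0 x hx).le
  funext m
  cases m with
  | zero => simp [insertRows, bumped, insertRowOpt, h, addLetter]
  | succ m => simp [insertRows_succ, insertRowOpt, h, addLetter, insertRows_none]

theorem insertRowOpt_append_of_lt {c : Option A} {M : A} {R : List A} (hc : ∀ x ∈ c, x < M) :
    insertRowOpt c (R ++ [M]) =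
      if c ≠ none ∧ (insertRowOpt c R).2 = none then ((insertRowOpt c R).1, some M)
      else ((insertRowOpt c R).1 ++ [M], (insertRowOpt c R).2) := by
  cases c with
  | none => simp [insertRowOpt]
  | some a => simpa [insertRowOpt] using insertRow_append_of_lt (by simpa using hc)

/-- A letter M above all others cannot influence the bumping until the bumping would end in the row
of M. There M is bumped instead, and it comes to rest at the end of the next row. This is the source
of the local rule. -/
theorem bumped_addLetter {T : ℕ → List A} {M a : A} (hT : ∀ m, ∀ x ∈ T m, x < M) (ha : a < M)
    {s : ℕ} (hs : ∀ m, (bumped (some a) T m ≠ none ∧ bumped (some a) T (m + 1) = none) ↔ m = s)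
    (r m : ℕ) :
    bumped (some a) (addLetter T M r) m =
      if m = r + 1 ∧ s = r then some M else bumped (some a) T m := by
  have hb := bumped_forall (P := (· < M)) (c := some a) (by simpa using ha) hT
  induction m with
  | zero => simp [bumped]
  | succ m ih =>
    rw [bumped, ih]
    by_cases h1 : m = r
    · subst h1
      have h2 := insertRowOpt_append_of_lt (R := T m) (hb m)
      have h3 := hs m
      rw [bumped] at h3
      simp only [addLetter, if_true]
      rw [if_neg (by omega), h2]
      by_cases h4 : m = s
      · rw [if_pos (h3.2 h4)]
        simp [h4]
      · rw [if_neg (fun h => h4 (h3.1 h)), if_neg (fun h => h4 h.2.symm), bumped]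
    · rw [if_neg (by omega : ¬ (m + 1 = r + 1 ∧ s = r))]
      simp only [addLetter, if_neg h1, List.append_nil]
      split_ifs with h2
      · obtain ⟨rfl, rfl⟩ := h2
        have h4 := ((hs s).2 rfl).2
        rw [bumped, h4, insertRowOpt, insertRowOpt,
          insertRow_of_forall_le fun x hx => (hT _ x hx).le]
      · rw [bumped]

theorem insertRows_addLetter {T : ℕ → List A} {M a : A} (hT : ∀ m, ∀ x ∈ T m, x < M) (ha : a < M)
    {s : ℕ} (hs : ∀ m, (bumped (some a) T m ≠ none ∧ bumped (some a) T (m + 1) = none) ↔ m = s)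
    (r : ℕ) :
    insertRows (some a) (addLetter T M r) =
      addLetter (insertRows (some a) T) M (if s = r then r + 1 else r) := by
  have hb := bumped_forall (P := (· < M)) (c := some a) (by simpa using ha) hT
  funext m
  rw [insertRows, bumped_addLetter hT ha hs]
  by_cases h1 : m = r
  · subst h1
    have h3 := hs m
    rw [bumped] at h3
    rw [if_neg (by omega), addLetter, if_pos rfl, insertRowOpt_append_of_lt (hb m)]
    by_cases h4 : m = s
    · rw [if_pos (h3.2 h4)]
      simp [addLetter, insertRows, h4]
    · rw [if_neg (fun h => h4 (h3.1 h))]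
      simp [addLetter, insertRows, Ne.symm h4]
  · simp only [addLetter, if_neg h1, List.append_nil]
    by_cases h2 : m = r + 1 ∧ s = r
    · obtain ⟨rfl, rfl⟩ := h2
      have h4 := ((hs s).2 rfl).2
      rw [if_pos ⟨rfl, rfl⟩, if_pos rfl, if_pos rfl, insertRows, h4, insertRowOpt, insertRowOpt,
        insertRow_of_forall_le fun x hx => (hT _ x hx).le]
    · rw [if_neg h2, insertRows]
      have : ¬ m = if s = r then r + 1 else r := by split_ifs <;> omega
      simp [this]

/-- The row lengths of the insertion tableau of a word. -/
def rowLengths (w : List A) (m : ℕ) : ℕ := (rows w m).length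

/-- One and the same s is the row of the new cell and the only row in which M would be hit, whatever
the row r of M. -/
theorem exists_insert_cell {w : List A} {M a : A} (hw : ∀ x ∈ w, x < M) (ha : a < M) :
    ∃ s, rowLengths (w ++ [a]) = rowLengths w + Pi.single s 1 ∧
      ∀ r, insertRows (some a) (addLetter (rows w) M r) =
        addLetter (rows (w ++ [a])) M (if s = r then r + 1 else r) := by
  obtain ⟨s, hs⟩ := exists_insertRows_last a (insertionTableau w)
  refine ⟨s, ?_, fun r => ?_⟩
  · funext m
    rw [rowLengths, rows_append_singleton, insertRows, length_insertRowOpt]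
    simp only [Pi.add_apply, Pi.single_apply, rowLengths]
    congr 1
    exact if_congr (hs m) rfl rfl
  · rw [rows_append_singleton]
    exact insertRows_addLetter (rows_forall hw) ha hs r

theorem rowLengths_of_addLetter {w v : List A} {M : A} {r : ℕ}
    (h : rows w = addLetter (rows v) M r) : rowLengths w = rowLengths v + Pi.single r 1 := by
  funext m
  rw [rowLengths, h, addLetter]
  simp only [List.length_append, Pi.add_apply, Pi.single_apply, rowLengths]
  split_ifs <;> rfl

theorem rowLengths_eq_zero {w : List A} {m : ℕ} (h : w.length ≤ m) : rowLengths w m = 0 := by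
  have h1 := List.length_le_sum_of_one_le ((insertionTableau w).map List.length) (by
    intro i hi
    obtain ⟨R, hR, rfl⟩ := List.mem_map.1 hi
    exact insertionTableau_pos w R hR)
  rw [insertionTableau_sum, List.length_map] at h1
  rw [rowLengths, rows, List.getD_eq_default _ _ (h1.trans h), List.length_nil]

end Rows

/-! ### Growth diagrams and Fomin's local rule -/

section Growth

/-- The word of the values below `j` at the positions below `i` of `g`. -/
def subword (g : ℕ → ℕ) (i j : ℕ) : List ℕ := ((List.range i).map g).filter (· < j)

/-- The row lengths of the insertion tableau of `subword g i j`. -/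
def growth (g : ℕ → ℕ) (i j : ℕ) : ℕ → ℕ := rowLengths (subword g i j)

variable {g : ℕ → ℕ}

theorem subword_lt (g : ℕ → ℕ) (i j : ℕ) : ∀ x ∈ subword g i j, x < j := by
  simp [subword]

theorem subword_succ_of_lt {i j : ℕ} (h : g i < j) :
    subword g (i + 1) j = subword g i j ++ [g i] := by
  simp [subword, List.range_succ, h]

theorem subword_succ_of_le {i j : ℕ} (h : j ≤ g i) : subword g (i + 1) j = subword g i j := by
  simp [subword, List.range_succ, h]

theorem subword_succ_right {i j : ℕ} (h : ∀ x < i, g x ≠ j) :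
    subword g i (j + 1) = subword g i j := by
  refine List.filter_congr fun y hy => ?_
  obtain ⟨x, hx, rfl⟩ := List.mem_map.1 hy
  have := h x (List.mem_range.1 hx)
  simp only [decide_eq_decide]
  omega

/-- The letter j is the largest of its word: it enters at the end of the first row, and every later
insertion leaves it where it is or pushes it to the end of the next row. -/
theorem exists_rows_subword_succ_right (hg : Function.Injective g) {i j : ℕ}
    (h : ∃ x < i, g x = j) :
    ∃ r, rows (subword g i (j + 1)) = addLetter (rows (subword g i j)) j r := by
  induction i with
  | zero => simp at h
  | succ i ih =>
    obtain ⟨x, hx, hxj⟩ := h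
    rcases lt_trichotomy (g i) j with h1 | h1 | h1
    · have hxi : x ≠ i := by rintro rfl; omega
      obtain ⟨r, hr⟩ := ih ⟨x, by omega, hxj⟩
      obtain ⟨s, -, hs⟩ := exists_insert_cell (subword_lt g i j) h1
      rw [subword_succ_of_lt h1, subword_succ_of_lt (by omega), rows_append_singleton, hr]
      exact ⟨_, hs r⟩
    · rw [subword_succ_of_lt (by omega), subword_succ_of_le h1.ge, rows_append_singleton,
        subword_succ_right fun y hy hyj => ?_, h1]
      · exact ⟨0, insertRows_addLetter_zero (rows_forall (subword_lt g i j))⟩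
      · exact absurd (hg (hyj.trans h1.symm)) (by omega)
    · have hxi : x ≠ i := by rintro rfl; omega
      rw [subword_succ_of_le (by omega), subword_succ_of_le h1.le]
      exact ih ⟨x, by omega, hxj⟩

/-- Fomin's local rule. -/
theorem growth_local (hg : Function.Injective g) (i j : ℕ) :
    (g i = j ∧ growth g (i + 1) j = growth g i j ∧ growth g i (j + 1) = growth g i j ∧
      growth g (i + 1) (j + 1) = growth g i j + Pi.single 0 1) ∨
    (g i ≠ j ∧
      ((growth g (i + 1) j = growth g i j ∧ growth g (i + 1) (j + 1) = growth g i (j + 1)) ∨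
      (growth g i (j + 1) = growth g i j ∧ growth g (i + 1) (j + 1) = growth g (i + 1) j) ∨
      ∃ r s, growth g (i + 1) j = growth g i j + Pi.single s 1 ∧
        growth g i (j + 1) = growth g i j + Pi.single r 1 ∧
        growth g (i + 1) (j + 1) =
          growth g i j + Pi.single s 1 + Pi.single (if s = r then r + 1 else r) 1)) := by
  unfold growth
  rcases lt_trichotomy (g i) j with h1 | h1 | h1
  · refine Or.inr ⟨h1.ne, Or.inr ?_⟩
    -- If j has occurred before position i, both words with bound j + 1 contain it as their largest
    -- letter; otherwise raising the bound changes neither word.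
    by_cases hx : ∃ x < i, g x = j
    · right
      obtain ⟨r, hr⟩ := exists_rows_subword_succ_right hg hx
      obtain ⟨s, hs, hs'⟩ := exists_insert_cell (subword_lt g i j) h1
      have h2 : rows (subword g i (j + 1) ++ [g i]) =
          addLetter (rows (subword g i j ++ [g i])) j (if s = r then r + 1 else r) := by
        rw [rows_append_singleton, hr, hs']
      rw [subword_succ_of_lt h1, subword_succ_of_lt (by omega : g i < j + 1)]
      exact ⟨r, s, hs, rowLengths_of_addLetter hr, by rw [rowLengths_of_addLetter h2, hs]⟩
    · left
      push Not at hx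
      rw [subword_succ_right hx, subword_succ_right]
      · simp
      · intro x hxi
        rcases Nat.lt_succ_iff_lt_or_eq.1 hxi with h | rfl
        · exact hx x h
        · omega
  · left
    have h2 : subword g i (j + 1) = subword g i j :=
      subword_succ_right fun y hy hyj => absurd (hg (hyj.trans h1.symm)) (by omega)
    have h3 : rows (subword g i j ++ [j]) = addLetter (rows (subword g i j)) j 0 := by
      rw [rows_append_singleton]
      exact insertRows_addLetter_zero (rows_forall (subword_lt g i j))
    rw [subword_succ_of_le h1.ge, subword_succ_of_lt (by omega : g i < j + 1), h2, h1,
      rowLengths_of_addLetter h3]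
    simp
  · refine Or.inr ⟨h1.ne', Or.inl ?_⟩
    rw [subword_succ_of_le h1.le, subword_succ_of_le (by omega : j + 1 ≤ g i)]
    simp

theorem growth_zero_left (g : ℕ → ℕ) (j : ℕ) : growth g 0 j = 0 := by
  funext m
  simp [growth, subword, rowLengths, rows_nil]

theorem growth_zero_right (g : ℕ → ℕ) (i : ℕ) : growth g i 0 = 0 := by
  funext m
  simp [growth, subword, rowLengths, rows_nil]

/-- That the row lengths form a partition is read off from the local rule, so no ordering of the
tableau entries is needed. When two cells are added to different rows, each is already admissible
alone; when s = r, the second goes directly below the first. -/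
theorem antitone_growth (hg : Function.Injective g) (i j : ℕ) : Antitone (growth g i j) := by
  induction i generalizing j with
  | zero => rw [growth_zero_left]; exact fun _ _ _ => le_rfl
  | succ i ihi =>
    induction j with
    | zero => rw [growth_zero_right]; exact fun _ _ _ => le_rfl
    | succ j ihj =>
      have hα := ihi j
      have hγ := ihi (j + 1)
      rcases growth_local hg i j with ⟨-, -, -, h⟩ | ⟨-, ⟨-, h⟩ | ⟨-, h⟩ | ⟨r, s, h1, h2, h⟩⟩
      · rw [h]
        refine antitone_nat_of_succ_le fun m => ?_
        have := hα (Nat.le_succ m)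
        simp only [Pi.add_apply, Pi.single_apply]
        split_ifs <;> simp at * <;> omega
      · rwa [h]
      · rwa [h]
      · rw [h]
        rw [h1] at ihj
        rw [h2] at hγ
        refine antitone_nat_of_succ_le fun m => ?_
        have e1 := hα (Nat.le_succ m)
        have e2 := ihj (Nat.le_succ m)
        have e3 := hγ (Nat.le_succ m)
        simp only [Pi.add_apply, Pi.single_apply, Nat.succ_eq_add_one] at *
        split_ifs at * <;> omega

/-! ### Symmetry for involutions -/

open Classical in
/-- The partition that Fomin's local rule assigns to the fourth corner of a cell. -/
noncomputable def fominCorner (x : Prop) (a b c : ℕ → ℕ) : ℕ → ℕ :=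
  if x then a + Pi.single 0 1
  else if b = c then fun m => b m + if m = 0 then 0 else b (m - 1) - a (m - 1)
  else fun m => b m + c m - a m

theorem fominCorner_comm (x : Prop) (a b c : ℕ → ℕ) :
    fominCorner x a b c = fominCorner x a c b := by
  unfold fominCorner
  split_ifs with h1 h2 h3 h3
  · rfl
  · rw [h2]
  · exact absurd h2.symm h3
  · exact absurd h3.symm h2
  · funext m
    rw [add_comm (b m)]

theorem single_one_injective {r s : ℕ}
    (h : (Pi.single r 1 : ℕ → ℕ) = Pi.single s 1) : r = s := by
  by_contra hrs
  have := congrFun h r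
  simp [hrs] at this

/-- The case distinction becomes a function of the other three corners, which is what an induction
on symmetry needs. For b = c, the difference b - a shifted down by one row is the new cell, or zero
if b = a. For b ≠ c, the sum b + c - a also covers the case in which one of them equals a. -/
theorem growth_succ_succ (hg : Function.Injective g) (i j : ℕ) :
    growth g (i + 1) (j + 1) =
      fominCorner (g i = j) (growth g i j) (growth g (i + 1) j) (growth g i (j + 1)) := by
  unfold fominCorner
  rcases growth_local hg i j with ⟨h0, -, -, h⟩ | ⟨h0, ⟨h1, h⟩ | ⟨h1, h⟩ | ⟨r, s, h1, h2, h⟩⟩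
  · rw [if_pos h0, h]
  · rw [if_neg h0, h1, h]
    split_ifs with h2
    · funext m
      simp [← h2]
    · simp
  · rw [if_neg h0, h1, h]
    split_ifs with h2
    · funext m
      simp [h2]
    · simp
  · rw [if_neg h0, h1, h2, h]
    by_cases hsr : s = r
    · subst hsr
      funext m
      simp only [if_true, Pi.add_apply, Pi.single_apply]
      split_ifs <;> omega
    · rw [if_neg (fun e => hsr (single_one_injective (add_left_cancel e))), if_neg hsr]
      funext m
      simp only [Pi.add_apply]
      omega

/-- For an involution the marked cells `g i = j` are symmetric about the diagonal, as are the empty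
boundary and the rule. -/
theorem growth_comm (hg : Function.Involutive g) (i j : ℕ) : growth g i j = growth g j i := by
  induction i generalizing j with
  | zero => rw [growth_zero_left, growth_zero_right]
  | succ i ihi =>
    induction j with
    | zero => rw [growth_zero_left, growth_zero_right]
    | succ j ihj =>
      have hx : (g i = j) = (g j = i) := by
        rw [eq_iff_iff]
        exact ⟨fun h => by rw [← h, hg], fun h => by rw [← h, hg]⟩
      rw [growth_succ_succ hg.injective, growth_succ_succ hg.injective, fominCorner_comm, hx,
        ihi, ihj, ihi]

theorem growth_eq_zero {i j m : ℕ} (h : i ≤ m) : growth g i j m = 0 := by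
  refine rowLengths_eq_zero (le_trans ?_ h)
  exact (List.length_filter_le _ _).trans (by simp)

/-! ### Alternating sums along the diagonal -/

/-- The alternating sum of the first `N` values of `f`. -/
def altSum (N : ℕ) (f : ℕ → ℕ) : ℤ := ∑ m ∈ Finset.range N, (-1) ^ m * (f m : ℤ)

theorem altSum_add_single {N r : ℕ} (h : r < N) (f : ℕ → ℕ) :
    altSum N (f + Pi.single r 1) = altSum N f + (-1) ^ r := by
  simp [altSum, mul_add, Finset.sum_add_distrib, Pi.single_apply, h]

theorem altSum_growth (hg : Function.Involutive g) {N i : ℕ} (hi : i < N) :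
    altSum N (growth g i i) = ((Finset.range i).filter fun x => g x = x).card := by
  induction i with
  | zero => simp [growth_zero_left, altSum]
  | succ i ih =>
    specialize ih (by omega)
    have hsymm := growth_comm hg i (i + 1)
    rw [Finset.range_add_one, Finset.filter_insert]
    rcases growth_local hg.injective i i with
      ⟨h0, -, -, h⟩ | ⟨h0, ⟨h1, h⟩ | ⟨h1, h⟩ | ⟨r, s, h1, h2, h⟩⟩
    · rw [h, altSum_add_single (by omega), ih, if_pos h0, Finset.card_insert_of_notMem (by simp)]
      simp
    · rw [if_neg h0, h, hsymm, h1, ih]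
    · rw [if_neg h0, h, ← hsymm, h1, ih]
    · have hsr : s = r :=
        single_one_injective (add_left_cancel (h1.symm.trans (hsymm.symm.trans h2)))
      subst hsr
      -- The word at (i, i + 1) has at most i letters, hence at most i rows. So row s + 1 is still
      -- within the cutoff N.
      have hs : s < i := by
        by_contra hs
        have := growth_eq_zero (g := g) (j := i + 1) (not_lt.1 hs)
        rw [h2] at this
        simp at this
      rw [if_neg h0, h, if_pos rfl, altSum_add_single (by omega), altSum_add_single (by omega), ih]
      ring

end Growth


/-! ### Odd columns and column lengths -/

section OddColumns

theorem filter_range_eq_range {p : ℕ → Prop} [DecidablePred p] (hp : ∀ m, p (m + 1) → p m)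
    (N : ℕ) : ∃ c, (Finset.range N).filter p = Finset.range c := by
  induction N with
  | zero => exact ⟨0, rfl⟩
  | succ N ih =>
    by_cases h : p N
    · refine ⟨N + 1, Finset.filter_true_of_mem fun m hm => ?_⟩
      exact Nat.decreasingInduction (motive := fun k _ => p k) (fun k _ hk => hp k hk) h
        (Finset.mem_range_succ_iff.1 hm)
    · rwa [Finset.range_add_one, Finset.filter_insert, if_neg h]

/-- The number of odd columns of a Young diagram is the alternating sum of its row lengths. -/
theorem card_odd_columns {f : ℕ → ℕ} (hf : Antitone f) {L : ℕ} (N : ℕ) (hL : ∀ m, f m ≤ L) :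
    (((Finset.Icc 1 L).filter fun j => Odd ((Finset.range N).filter (j ≤ f ·)).card).card : ℤ) =
      altSum N f := by
  -- Each row length is written as a count of cells, so that the double sum can be taken by columns.
  have h1 : ∀ m, (f m : ℤ) = ∑ j ∈ Finset.Icc 1 L, if j ≤ f m then 1 else 0 := by
    intro m
    rw [← Finset.sum_filter, Finset.sum_const, nsmul_one]
    have : (Finset.Icc 1 L).filter (· ≤ f m) = Finset.Icc 1 (f m) := by
      ext j
      have := hL m
      simp only [Finset.mem_filter, Finset.mem_Icc]
      omega
    rw [this, Nat.card_Icc, Nat.add_sub_cancel]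
  simp only [altSum, h1, Finset.mul_sum]
  rw [Finset.sum_comm, Finset.card_filter, Nat.cast_sum]
  refine Finset.sum_congr rfl fun j _ => ?_
  simp only [mul_ite, mul_one, mul_zero]
  rw [← Finset.sum_filter]
  -- Column j fills an initial segment of c rows, and 1 - 1 + 1 - ⋯ with c terms is 1 or 0 according
  -- to the parity of c.
  obtain ⟨c, hc⟩ := filter_range_eq_range (p := (j ≤ f ·)) (fun m h => h.trans (hf m.le_succ)) N
  rw [hc, neg_one_geom_sum, Finset.card_range]
  by_cases h : Even c
  · simp [h]
  · simp [h, Nat.not_even_iff_odd.1 h]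

theorem parts_le {n : ℕ} (μ : n.Partition) {i : ℕ} (hi : i ∈ μ.parts) : i ≤ n := by
  conv_rhs => rw [← μ.parts_sum]
  exact Multiset.single_le_sum (fun _ _ => Nat.zero_le _) i hi

theorem colLength_antitone {n : ℕ} (μ : n.Partition) : Antitone (colLength μ) := fun _ _ h => by
  simp only [colLength, Multiset.countP_eq_card_filter]
  exact Multiset.card_le_card (Multiset.monotone_filter_right _ fun _ hi => h.trans hi)

theorem colLength_eq_zero {n : ℕ} (μ : n.Partition) {j : ℕ} (h : n < j) : colLength μ j = 0 :=
  Multiset.countP_eq_zero.2 fun _ hi => by have := parts_le μ hi; omega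

/-- Columns beyond the largest part are empty, hence even, so the bound may be the uniform n. -/
theorem numOddColumns_eq {n : ℕ} (μ : n.Partition) :
    numOddColumns μ = ((Finset.Icc 1 n).filter fun j => Odd (colLength μ j)).card := by
  refine congrArg Finset.card (Finset.ext fun j => ?_)
  simp only [Finset.mem_filter, Finset.mem_Icc]
  refine ⟨fun ⟨⟨h1, h2⟩, h3⟩ => ⟨⟨h1, ?_⟩, h3⟩, fun ⟨⟨h1, h2⟩, h3⟩ => ⟨⟨h1, ?_⟩, h3⟩⟩
  · by_contra h
    rw [colLength_eq_zero μ (by omega)] at h3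
    exact absurd h3 (by decide)
  · obtain ⟨i, hi, hj⟩ := Multiset.countP_pos.1 h3.pos
    exact le_trans hj (Multiset.le_sup hi)

theorem countP_le_eq (s : Multiset ℕ) (a : ℕ) :
    s.countP (a ≤ ·) = s.countP (a + 1 ≤ ·) + s.count a := by
  induction s using Multiset.induction_on with
  | empty => rfl
  | cons b s ih =>
    rw [Multiset.countP_cons, Multiset.countP_cons, Multiset.count_cons, ih]
    split_ifs <;> omega

theorem partition_ext {n : ℕ} {μ ν : n.Partition}
    (h : ∀ j, 1 ≤ j → colLength μ j = colLength ν j) : μ = ν := by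
  refine Nat.Partition.ext (Multiset.ext.2 fun a => ?_)
  rcases Nat.eq_zero_or_pos a with rfl | ha
  · rw [Multiset.count_eq_zero.2 fun h => absurd (μ.parts_pos h) (by omega),
      Multiset.count_eq_zero.2 fun h => absurd (ν.parts_pos h) (by omega)]
  · have h1 := h a ha
    have h2 := h (a + 1) (by omega)
    unfold colLength at h1 h2
    rw [countP_le_eq μ.parts a, countP_le_eq ν.parts a] at h1
    omega

theorem sum_countP_le {n : ℕ} (s : Multiset ℕ) (hs : ∀ i ∈ s, i ≤ n) :
    ∑ t ∈ Finset.range n, s.countP (t + 1 ≤ ·) = s.sum := by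
  induction s using Multiset.induction_on with
  | empty => simp
  | cons b s ih =>
    have hb := hs b (by simp)
    simp only [Multiset.countP_cons, Finset.sum_add_distrib, Multiset.sum_cons]
    rw [ih fun i hi => hs i (by simp [hi]), ← Finset.card_filter, add_comm]
    have : (Finset.range n).filter (fun t => t + 1 ≤ b) = Finset.range b := by
      ext t
      simp only [Finset.mem_filter, Finset.mem_range]
      omega
    rw [this, Finset.card_range]

end OddColumns

/-! ### From words to shapes; Schützenberger's theorem -/

section Shape

theorem countP_map_length {A : Type*} (T : List (List A)) {N j : ℕ} (hN : T.length ≤ N) (hj : 1 ≤ j) :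
    (T.map List.length).countP (j ≤ ·) =
      ((Finset.range N).filter fun m => j ≤ (T.getD m []).length).card := by
  induction T generalizing N with
  | nil =>
    have : ¬ j ≤ 0 := by omega
    simp [this]
  | cons R T ih =>
    obtain ⟨N, rfl⟩ : ∃ M, N = M + 1 := ⟨N - 1, by simp at hN; omega⟩
    rw [List.map_cons, List.countP_cons, ih (N := N) (by simpa using hN), Finset.card_filter,
      Finset.card_filter, Finset.sum_range_succ']
    simp

variable {A B : Type*} [LinearOrder A] [LinearOrder B]

theorem insertRow_map {f : A → B} (hf : StrictMono f) (a : A) (R : List A) :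
    insertRow (f a) (R.map f) = ((insertRow a R).1.map f, (insertRow a R).2.map f) := by
  induction R with
  | nil => rfl
  | cons b R ih =>
    simp only [List.map_cons, insertRow, hf.lt_iff_lt]
    split_ifs <;> simp [ih]

theorem insertTableau_map {f : A → B} (hf : StrictMono f) (a : A) (T : List (List A)) :
    insertTableau (f a) (T.map (List.map f)) = (insertTableau a T).map (List.map f) := by
  induction T generalizing a with
  | nil => rfl
  | cons R T ih =>
    cases h : (insertRow a R).2 with
    | none => simp [insertTableau, insertRow_map hf, h]
    | some b => simp [insertTableau, insertRow_map hf, h, ih]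

/-- Insertion only compares letters, so words over `Fin n` may be replaced by words over ℕ, where
growth diagrams are defined. -/
theorem insertionTableau_map {f : A → B} (hf : StrictMono f) (w : List A) :
    insertionTableau (w.map f) = (insertionTableau w).map (List.map f) := by
  induction w using List.reverseRecOn with
  | nil => rfl
  | append_singleton w a ih =>
    simp only [insertionTableau, List.map_append, List.map_cons, List.map_nil, List.foldl_append,
      List.foldl_cons, List.foldl_nil] at ih ⊢
    rw [ih, insertTableau_map hf]

theorem colLength_sh {n : ℕ} {σ : Equiv.Perm (Fin n)} {g : ℕ → ℕ} (hg : ∀ x : Fin n, g x = σ x)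
    {N j : ℕ} (hN : n ≤ N) (hj : 1 ≤ j) :
    colLength (sh σ) j =
      ((Finset.range N).filter fun m => j ≤ rowLengths ((List.range n).map g) m).card := by
  have h1 : (List.range n).map g = (oneLine σ).map Fin.val := by
    refine List.ext_getElem (by simp [oneLine]) fun i h _ => ?_
    have hi : i < n := by simpa using h
    simpa [oneLine] using hg ⟨i, hi⟩
  have h2 := List.length_le_sum_of_one_le ((tableauP σ).map List.length) (by
    intro i hi
    obtain ⟨R, hR, rfl⟩ := List.mem_map.1 hi
    exact insertionTableau_pos _ R hR)
  rw [tableauP, insertionTableau_sum, List.length_map, oneLine, List.length_ofFn] at h2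
  have h3 := countP_map_length (insertionTableau ((oneLine σ).map Fin.val)) (N := N) (j := j)
    (by rw [insertionTableau_map Fin.val_strictMono, List.length_map]; exact h2.trans hN) hj
  rw [h1]
  refine Eq.trans ?_ h3
  rw [insertionTableau_map Fin.val_strictMono]
  simp [colLength, sh, tableauP, Function.comp_def]

/-- Schützenberger's theorem: the number of fixed points of an involution is the number of odd
columns of its RS shape. -/
theorem numOddColumns_sh {n : ℕ} {σ : Equiv.Perm (Fin n)} (hσ : ∀ x, σ (σ x) = x) :
    numOddColumns (sh σ) = (Finset.univ.filter fun x => σ x = x).card := by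
  -- Extension by the identity keeps g an involution of all of ℕ.
  let g : ℕ → ℕ := fun x => if h : x < n then (σ ⟨x, h⟩ : ℕ) else x
  have hgσ : ∀ x : Fin n, g x = σ x := fun x => by simp [g]
  have hg : Function.Involutive g := by
    intro x
    by_cases h : x < n
    · have h1 : g x = σ ⟨x, h⟩ := by simp [g, h]
      rw [h1, hgσ, hσ]
    · simp [g, h]
  have hw : growth g n n = rowLengths ((List.range n).map g) := by
    unfold growth subword
    congr 1
    refine List.filter_eq_self.2 fun y hy => ?_
    obtain ⟨x, hx, rfl⟩ := List.mem_map.1 hy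
    have hx : x < n := by simpa using hx
    simp [g, hx]
  have hanti := antitone_growth hg.injective n n
  have h1 := altSum_growth hg (Nat.lt_succ_self n)
  -- A row longer than n would force the first row to be so, contradicting that column n + 1 is
  -- empty.
  have hL : ∀ m, growth g n n m ≤ n := by
    intro m
    by_contra hm
    have h2 := colLength_sh hgσ (Nat.le_succ n) (j := n + 1) (by omega)
    rw [colLength_eq_zero _ (Nat.lt_succ_self n), ← hw] at h2
    have h3 := Finset.card_eq_zero.1 h2.symm
    have h4 : 0 ∈ (Finset.range (n + 1)).filter fun m => n + 1 ≤ growth g n n m := by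
      have := hanti (Nat.zero_le m)
      simp only [Finset.mem_filter, Finset.mem_range]
      omega
    rw [h3] at h4
    simp at h4
  have h2 := card_odd_columns hanti (n + 1) hL
  rw [h1] at h2
  have h3 := Nat.cast_injective h2
  rw [numOddColumns_eq]
  rw [Finset.card_filter (fun x => g x = x), Finset.sum_range] at h3
  rw [Finset.card_filter (fun x => σ x = x)]
  have h4 : ∀ x : Fin n, (g x = x) = (σ x = x) := fun x => by rw [hgσ, Fin.val_inj]
  simp only [h4] at h3
  rw [← h3]
  refine congrArg Finset.card (Finset.filter_congr fun j hj => ?_)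
  rw [colLength_sh hgσ (Nat.le_succ n) (Finset.mem_Icc.1 hj).1, hw]

end Shape

/-! ### Every partition is the shape of an involution -/

section Blocks

variable {A : Type*} [LinearOrder A]

theorem insertRow_append_singleton {a y : A} {R : List A} (hR : ∀ x ∈ R, x ≤ a) (hy : a < y) :
    insertRow a (R ++ [y]) = (R ++ [a], some y) := by
  rw [insertRow_append_of_lt hy, insertRow_of_forall_le hR]
  simp

/-- The letter a is smaller than the appended column l and at least every entry of T, so it bumps
the top of l and each letter of l moves down one row. Past the end of l the optional entries are
`none`, and the bumping stops. -/
theorem insertRows_column {T : ℕ → List A} {a : A} {l : List A} (hl : (a :: l).Pairwise (· < ·))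
    (hT : ∀ m, ∀ x ∈ T m, x ≤ a) :
    insertRows (some a) (fun m => T m ++ l[m]?.toList) =
      fun m => T m ++ (a :: l)[m]?.toList := by
  have key : ∀ m, insertRowOpt (a :: l)[m]? (T m ++ l[m]?.toList) =
      (T m ++ (a :: l)[m]?.toList, (a :: l)[m + 1]?) := by
    intro m
    rcases lt_or_ge m (a :: l).length with h | h
    · rw [List.getElem?_eq_getElem h]
      have h1 : a ≤ (a :: l)[m] := by
        rcases Nat.eq_zero_or_pos m with rfl | hm
        · rfl
        · exact (List.pairwise_iff_getElem.1 hl 0 m (by simp) h hm).le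
      have h2 : ∀ x ∈ T m, x ≤ (a :: l)[m] := fun x hx => (hT m x hx).trans h1
      rw [insertRowOpt, List.getElem?_cons_succ]
      rcases lt_or_ge m l.length with h3 | h3
      · have h4 : (a :: l)[m] < l[m] := by
          exact List.pairwise_iff_getElem.1 hl m (m + 1) h (by simpa using h3) (by omega)
        rw [List.getElem?_eq_getElem h3]
        exact insertRow_append_singleton h2 h4
      · rw [List.getElem?_eq_none h3]
        simpa using insertRow_of_forall_le h2
    · have h1 : l.length ≤ m := by simp at h; omega
      rw [List.getElem?_eq_none h, List.getElem?_eq_none h1, List.getElem?_eq_none (by omega)]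
      rfl
  have hb : ∀ m, bumped (some a) (fun m => T m ++ l[m]?.toList) m = (a :: l)[m]? := by
    intro m
    induction m with
    | zero => rfl
    | succ m ih => rw [bumped, ih, key]
  funext m
  rw [insertRows, hb, key]

theorem rows_append_decreasing {u v : List A} (hv : v.reverse.Pairwise (· < ·))
    (huv : ∀ x ∈ u, ∀ y ∈ v, x ≤ y) :
    rows (u ++ v) = fun m => rows u m ++ v.reverse[m]?.toList := by
  induction v using List.reverseRecOn with
  | nil => simp
  | append_singleton v a ih =>
    rw [List.reverse_append, List.reverse_singleton, List.singleton_append] at hv ⊢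
    rw [← List.append_assoc, rows_append_singleton,
      ih hv.of_cons fun x hx y hy => huv x hx y (by simp [hy])]
    exact insertRows_column hv (rows_forall fun x hx => huv x hx a (by simp))

/-- The involution of `ℕ` that reverses consecutive blocks; the block lengths are listed from the
last block to the first. -/
def blockReverse : List ℕ → ℕ → ℕ
  | [], x => x
  | c :: cs, x =>
      if x < cs.sum then blockReverse cs x
      else if x < cs.sum + c then 2 * cs.sum + c - 1 - x else x

theorem blockReverse_lt (cs : List ℕ) {x : ℕ} (hx : x < cs.sum) : blockReverse cs x < cs.sum := by
  induction cs generalizing x with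
  | nil => simp at hx
  | cons c cs ih =>
    rw [List.sum_cons] at hx ⊢
    rw [blockReverse]
    split_ifs with h1 h2
    · have := ih h1; omega
    · omega
    · omega

theorem blockReverse_blockReverse (cs : List ℕ) (x : ℕ) :
    blockReverse cs (blockReverse cs x) = x := by
  induction cs generalizing x with
  | nil => rfl
  | cons c cs ih =>
    by_cases h1 : x < cs.sum
    · simp [blockReverse, h1, blockReverse_lt cs h1, ih]
    · by_cases h2 : x < cs.sum + c
      · simp only [blockReverse, h1, h2, if_true, if_false]
        rw [if_neg (by omega), if_pos (by omega)]
        omega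
      · simp [blockReverse, h1, h2]

theorem rowLengths_blockReverse (cs : List ℕ) (m : ℕ) :
    rowLengths ((List.range cs.sum).map (blockReverse cs)) m = cs.countP (m < ·) := by
  induction cs with
  | nil => simp [rowLengths, rows_nil]
  | cons c cs ih =>
    -- The decreasing run contributed by the last block; it adds one cell to each of the first c
    -- rows.
    let v := (List.range c).map fun i => cs.sum + c - 1 - i
    have hw : (List.range (c :: cs).sum).map (blockReverse (c :: cs)) =
        (List.range cs.sum).map (blockReverse cs) ++ v := by
      rw [List.sum_cons, add_comm, List.range_add, List.map_append, List.map_map]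
      congr 1
      · refine List.map_congr_left fun x hx => ?_
        simp [blockReverse, List.mem_range.1 hx]
      · refine List.map_congr_left fun x hx => ?_
        have := List.mem_range.1 hx
        simp only [Function.comp_apply, blockReverse]
        rw [if_neg (by omega), if_pos (by omega)]
        omega
    have hv : v.reverse = (List.range c).map (cs.sum + ·) := by
      refine List.ext_getElem (by simp [v]) fun i h1 h2 => ?_
      have : i < c := by simpa using h2
      simp only [v, List.getElem_reverse, List.getElem_map, List.getElem_range, List.length_map,
        List.length_range]
      omega
    have hr := rows_append_decreasing (u := (List.range cs.sum).map (blockReverse cs)) (v := v)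
      (by
        rw [hv, List.pairwise_map]
        exact List.pairwise_lt_range.imp fun h => by omega)
      (by
        intro x hx y hy
        obtain ⟨i, hi, rfl⟩ := List.mem_map.1 hx
        obtain ⟨k, hk, rfl⟩ := List.mem_map.1 hy
        have := blockReverse_lt cs (List.mem_range.1 hi)
        have := List.mem_range.1 hk
        omega)
    rw [hw, rowLengths, hr, List.length_append, hv, List.countP_cons, ← ih, rowLengths]
    congr 1
    by_cases h : m < c
    · simp [h]
    · simp [h]

theorem countP_range (p : ℕ → Prop) [DecidablePred p] (n : ℕ) :
    (List.range n).countP (fun t => decide (p t)) = ((Finset.range n).filter p).card := by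
  rw [← Nat.count_eq_card_filter_range]
  rfl

/-- Every partition is the RS shape of an involution. -/
theorem exists_involution_sh_eq {n : ℕ} (μ : n.Partition) :
    ∃ σ : Equiv.Perm (Fin n), (∀ x, σ (σ x) = x) ∧ sh σ = μ := by
  -- The shift by one is because columns are numbered from 1. Columns past the largest part give
  -- empty blocks.
  let cs := (List.range n).map fun t => colLength μ (t + 1)
  have hsum : cs.sum = n := by
    have h1 := sum_countP_le μ.parts fun i hi => parts_le μ hi
    rw [μ.parts_sum] at h1
    conv_rhs => rw [← h1]
    rfl
  have hlt : ∀ x : Fin n, blockReverse cs x < n := fun x => by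
    have := blockReverse_lt cs (x := x) (by rw [hsum]; exact x.2)
    rwa [hsum] at this
  let f : Fin n → Fin n := fun x => ⟨blockReverse cs x, hlt x⟩
  have hf : Function.Involutive f := fun x => Fin.ext (blockReverse_blockReverse cs x)
  refine ⟨hf.toPerm, hf, partition_ext fun j hj => ?_⟩
  rw [colLength_sh (g := blockReverse cs) (fun _ => rfl) le_rfl hj]
  have hrow : ∀ m, rowLengths ((List.range n).map (blockReverse cs)) m =
      ((Finset.range n).filter fun t => m < colLength μ (t + 1)).card := by
    intro m
    have := rowLengths_blockReverse cs m
    rw [hsum] at this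
    rw [this, List.countP_map]
    exact countP_range _ n
  -- Conjugation: as column lengths decrease weakly, at least j columns are longer than m exactly
  -- when column j is.
  have hiff : ∀ m, j ≤ rowLengths ((List.range n).map (blockReverse cs)) m ↔
      m < colLength μ j := by
    intro m
    rw [hrow]
    constructor
    · intro h
      by_contra hm
      have : (Finset.range n).filter (fun t => m < colLength μ (t + 1)) ⊆
          Finset.range (j - 1) := by
        intro t ht
        rw [Finset.mem_filter] at ht
        by_contra hjt
        rw [Finset.mem_range] at hjt
        have := colLength_antitone μ (show j ≤ t + 1 by omega)
        omega
      have := Finset.card_le_card this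
      rw [Finset.card_range] at this
      omega
    · intro h
      have hjn : j ≤ n := by
        by_contra hjn
        rw [colLength_eq_zero μ (by omega)] at h
        omega
      have : Finset.range j ⊆ (Finset.range n).filter (fun t => m < colLength μ (t + 1)) := by
        intro t ht
        rw [Finset.mem_range] at ht
        have := colLength_antitone μ (show t + 1 ≤ j by omega)
        rw [Finset.mem_filter, Finset.mem_range]
        omega
      simpa using Finset.card_le_card this
  -- All parts are positive, so there are at most n of them and the cutoff at n rows loses nothing.
  have hcol : colLength μ j ≤ n := by
    have h1 : colLength μ j ≤ μ.parts.card := Multiset.countP_le_card _ _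
    have h2 : μ.parts.card • 1 ≤ μ.parts.sum :=
      Multiset.card_nsmul_le_sum fun x hx => μ.parts_pos hx
    rw [μ.parts_sum] at h2
    simpa using h1.trans (by simpa using h2)
  have : (Finset.range n).filter
      (fun m => j ≤ rowLengths ((List.range n).map (blockReverse cs)) m) =
      Finset.range (colLength μ j) := by
    ext m
    rw [Finset.mem_filter, hiff, Finset.mem_range, Finset.mem_range]
    omega
  rw [this, Finset.card_range]

end Blocks

/-! ### Cycle types of involutions -/

section CycleType

theorem partition_parts_eq {n : ℕ} {σ : Equiv.Perm (Fin n)} {k l : ℕ} (hn : 2 * l + k = n)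
    (hσ : ∀ x, σ (σ x) = x) (hk : (Finset.univ.filter fun x => σ x = x).card = k) :
    σ.partition.parts = Multiset.replicate l 2 + Multiset.replicate k 1 := by
  have hc : σ.cycleType = Multiset.replicate σ.cycleType.card 2 := by
    refine Multiset.eq_replicate_card.2 fun i hi => ?_
    have h1 : σ ^ 2 = 1 := Equiv.ext fun x => by simp [pow_two, hσ]
    have h2 := (Equiv.Perm.dvd_of_mem_cycleType hi).trans (orderOf_dvd_of_pow_eq_one h1)
    have h3 := Nat.le_of_dvd (by omega) h2
    have h4 := Equiv.Perm.two_le_of_mem_cycleType hi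
    omega
  have hs : (Finset.univ.filter fun x => σ x = x).card + σ.support.card = n := by
    simpa [Equiv.Perm.support] using
      Finset.card_filter_add_card_filter_not (s := Finset.univ) (fun x => σ x = x)
  have h1 := σ.sum_cycleType
  rw [hc, Multiset.sum_replicate, smul_eq_mul] at h1
  rw [Equiv.Perm.parts_partition, hc, Fintype.card_fin,
    show σ.cycleType.card = l by omega, show n - σ.support.card = k by omega]

theorem involutive_of_partition_parts {n : ℕ} {σ : Equiv.Perm (Fin n)} {k l : ℕ}
    (h : σ.partition.parts = Multiset.replicate l 2 + Multiset.replicate k 1) :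
    (∀ x, σ (σ x) = x) ∧ (Finset.univ.filter fun x => σ x = x).card = k := by
  have hs : (Finset.univ.filter fun x => σ x = x).card + σ.support.card = n := by
    simpa [Equiv.Perm.support] using
      Finset.card_filter_add_card_filter_not (s := Finset.univ) (fun x => σ x = x)
  rw [Equiv.Perm.parts_partition, Fintype.card_fin] at h
  constructor
  · have h1 : σ ^ 2 = 1 := by
      rw [← orderOf_dvd_iff_pow_eq_one, ← Equiv.Perm.lcm_cycleType]
      refine Multiset.lcm_dvd.2 fun i hi => ?_
      have h2 : i ∈ Multiset.replicate l 2 + Multiset.replicate k 1 := by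
        rw [← h]
        exact Multiset.mem_add.2 (Or.inl hi)
      rcases Multiset.mem_add.1 h2 with h3 | h3
      · rw [Multiset.eq_of_mem_replicate h3]
      · rw [Multiset.eq_of_mem_replicate h3]
        exact one_dvd 2
    intro x
    simpa [pow_two] using Equiv.congr_fun h1 x
  · have h1 := congrArg (Multiset.count 1) h
    -- `cycleType` omits fixed points, so the parts equal to 1 are exactly those added for the
    -- complement of the support.
    have h2 : Multiset.count 1 σ.cycleType = 0 :=
      Multiset.count_eq_zero.2 fun hm => absurd (Equiv.Perm.two_le_of_mem_cycleType hm) (by omega)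
    simp [Multiset.count_replicate, h2] at h1
    omega

end CycleType

end RobinsonSchensted

theorem proposition6p2 (n r k : ℕ) (hkr : k ≤ r) (α : n.Partition)
    (hα : α.parts = Multiset.replicate (r - k) 2 + Multiset.replicate k 1) :
    RobinsonSchensted.shapes α =
      {μ : n.Partition | RobinsonSchensted.numOddColumns μ = k} := by
  have hn : 2 * (r - k) + k = n := by
    have := α.parts_sum
    rw [hα] at this
    simp at this
    omega
  ext μ
  constructor
  · rintro ⟨σ, hσ, rfl⟩
    obtain ⟨h1, h2⟩ := RobinsonSchensted.involutive_of_partition_parts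
      (Eq.trans (show σ.partition.parts = α.parts from hσ) hα)
    exact (RobinsonSchensted.numOddColumns_sh h1).trans h2
  · intro hμ
    -- Any involution of shape μ will do: Schützenberger's theorem forces it to have k fixed points,
    -- and this fixes its cycle type.
    obtain ⟨σ, h1, rfl⟩ := RobinsonSchensted.exists_involution_sh_eq μ
    refine ⟨σ, ?_, rfl⟩
    exact (RobinsonSchensted.partition_parts_eq hn h1
      ((RobinsonSchensted.numOddColumns_sh h1).symm.trans hμ)).trans hα.symm
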